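/- Theorem (Jespers–Parmenter). For a finite group $G$ and $g\in G$ of order $n$, write $\widetilde{g}=1+g+\cdots+g^{n-1}\in\mathbb{Z}G$. The bicyclic units of $\mathbb{Z}G$ are the units $1+(1-g)h\widetilde{g}$ and $1+\widetilde{g}h(1-g)$ with $g,h\in G$. The Bass units of $\mathbb{Z}G$ are the units $$u_{k,m}(g)=(1+g+\cdots+g^{k-1})^m+\frac{1-k^m}{n}\,\widetilde{g},$$ where $g\in G$ has order $n$ and $k,m$ are positive integers with $\gcd(k,n)=1$ and $k^m\equiv 1 \pmod n$. Let $D_8=\langle a,b\mid a^4=1,\ b^2=1,\ ba=a^3b\rangle$ be the dihedral group of order $8$. Let $G$ be a finite $2$-group and let $f:G\to D_8$ be an epimorphism. If at least two of the elements $b,ab,a^2b,a^3b$ do not have a preimage under $f$ of order $2$, then the Bass units together with the bicyclic units of $\mathbb{Z}G$ do not generate a subgroup of finite index in the unit group $\mathcal{U}(\mathbb{Z}G)$. In particular, this applies to (that is, each of the following groups is a finite $2$-group having such an epimorphism onto $D_8$, and hence the conclusion holds for it): 1. the generalized quaternion group $Q_{16}$ of order $16$; 2. $\langle a,b\mid a^8=1,\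 b^2=1,\ ba=a^3b\rangle$; 3. $C_4\rtimes C_4$, where a generator of the right factor acts on the left factor by inversion; 4. $(\langle z\rangle_2\times\langle a\rangle_4)\rtimes\langle b\rangle_2$, with $z$ central and $b^{-1}ab=za$, where subscripts denote the orders of the cyclic groups. -/

import Mathlib

namespace GroupRingUnits

section Elements

variable {G : Type*} [Group G]

/-- The element `1 + g + ⋯ + g ^ (k - 1)` of `ℤG`. -/
noncomputable def geomSum (g : G) (k : ℕ) : MonoidAlgebra ℤ G :=
  ∑ i ∈ Finset.range k, MonoidAlgebra.of ℤ G (g ^ i)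

/-- `g̃ = 1 + g + ⋯ + g ^ (n - 1)`, where `n` is the order of `g`. -/
noncomputable def tildeElt (g : G) : MonoidAlgebra ℤ G :=
  geomSum g (orderOf g)

/-- `u_{k,m}(g) = (1 + g + ⋯ + g ^ (k - 1)) ^ m + ((1 - k ^ m) / n) g̃`, where `n` is the order of
`g`. The integer division is exact as soon as `k ^ m ≡ 1` modulo `n`. -/
noncomputable def bassElt (g : G) (k m : ℕ) : MonoidAlgebra ℤ G :=
  geomSum g k ^ m + ((1 - (k : ℤ) ^ m) / (orderOf g : ℤ)) • tildeElt g

/-- `b(h, g̃) = 1 + (1 - g) h g̃`. -/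
noncomputable def bicyclicEltRight (h g : G) : MonoidAlgebra ℤ G :=
  1 + (1 - MonoidAlgebra.of ℤ G g) * MonoidAlgebra.of ℤ G h * tildeElt g

/-- `b(g̃, h) = 1 + g̃ h (1 - g)`. -/
noncomputable def bicyclicEltLeft (g h : G) : MonoidAlgebra ℤ G :=
  1 + tildeElt g * MonoidAlgebra.of ℤ G h * (1 - MonoidAlgebra.of ℤ G g)

end Elements

/-- The Bass units of `ℤG`: the units `u_{k,m}(g)` with `g ∈ G` and positive integers `k`, `m`
such that `k` is coprime to the order `n` of `g` and `k ^ m ≡ 1` modulo `n`. -/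
def bassUnits (G : Type*) [Group G] : Set (MonoidAlgebra ℤ G)ˣ :=
  {u | ∃ (g : G) (k m : ℕ), 0 < k ∧ 0 < m ∧ k.Coprime (orderOf g) ∧ k ^ m ≡ 1 [MOD orderOf g] ∧
    (u : MonoidAlgebra ℤ G) = bassElt g k m}

/-- The bicyclic units of `ℤG`, of both types `b(h, g̃)` and `b(g̃, h)`, with `g, h ∈ G`. -/
def bicyclicUnits (G : Type*) [Group G] : Set (MonoidAlgebra ℤ G)ˣ :=
  {u | ∃ g h : G, (u : MonoidAlgebra ℤ G) = bicyclicEltRight h g ∨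
    (u : MonoidAlgebra ℤ G) = bicyclicEltLeft g h}

/-- The subgroup of the unit group of `ℤG` generated by the Bass units and the bicyclic units. -/
noncomputable def bassBicyclicSubgroup (G : Type*) [Group G] : Subgroup (MonoidAlgebra ℤ G)ˣ :=
  Subgroup.closure (bassUnits G ∪ bicyclicUnits G)

section Checks

/-! The elements above really are units, so that the two sets of units contain all of them. -/

variable {G : Type*} [Group G]

theorem of_mul_tildeElt (g : G) : MonoidAlgebra.of ℤ G g * tildeElt g = tildeElt g := by
  have h : (MonoidAlgebra.of ℤ G g - 1) * tildeElt g = 0 := by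
    have := mul_geom_sum (MonoidAlgebra.of ℤ G g) (orderOf g)
    simp only [tildeElt, geomSum, map_pow]
    rw [this, ← map_pow, pow_orderOf_eq_one, map_one, sub_self]
  rw [sub_mul, one_mul, sub_eq_zero] at h
  exact h

theorem tildeElt_mul_of (g : G) : tildeElt g * MonoidAlgebra.of ℤ G g = tildeElt g := by
  have h : tildeElt g * (MonoidAlgebra.of ℤ G g - 1) = 0 := by
    have := geom_sum_mul (MonoidAlgebra.of ℤ G g) (orderOf g)
    simp only [tildeElt, geomSum, map_pow]
    rw [this, ← map_pow, pow_orderOf_eq_one, map_one, sub_self]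
  rw [mul_sub, mul_one, sub_eq_zero] at h
  exact h

theorem isUnit_one_add_of_sq {R : Type*} [Ring R] (x : R) (h : x * x = 0) : IsUnit (1 + x) :=
  ⟨⟨1 + x, 1 - x, by simp [add_mul, mul_sub, h], by simp [sub_mul, mul_add, h]⟩, rfl⟩

theorem isUnit_bicyclicEltRight (h g : G) : IsUnit (bicyclicEltRight h g) := by
  apply isUnit_one_add_of_sq
  have : tildeElt g * (1 - MonoidAlgebra.of ℤ G g) = 0 := by
    rw [mul_sub, mul_one, tildeElt_mul_of, sub_self]
  simp only [mul_assoc]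
  rw [← mul_assoc (tildeElt g) (1 - _), this]
  simp

theorem isUnit_bicyclicEltLeft (g h : G) : IsUnit (bicyclicEltLeft g h) := by
  apply isUnit_one_add_of_sq
  have : (1 - MonoidAlgebra.of ℤ G g) * tildeElt g = 0 := by
    rw [sub_mul, one_mul, of_mul_tildeElt, sub_self]
  simp only [mul_assoc]
  rw [← mul_assoc (1 - _) (tildeElt g), this]
  simp

theorem of_pow_mul_tildeElt (g : G) (i : ℕ) :
    MonoidAlgebra.of ℤ G (g ^ i) * tildeElt g = tildeElt g := by
  induction i with
  | zero => rw [pow_zero, map_one, one_mul]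
  | succ j ih => rw [pow_succ, map_mul, mul_assoc, of_mul_tildeElt, ih]

theorem geomSum_mul_tildeElt (g : G) (a k : ℕ) :
    geomSum (g ^ a) k * tildeElt g = (k : ℤ) • tildeElt g := by
  rw [geomSum, Finset.sum_mul, Finset.sum_congr rfl fun i _ => by
    rw [← pow_mul, of_pow_mul_tildeElt]]
  rw [Finset.sum_const, Finset.card_range, natCast_zsmul]

theorem geomSum_pow_mul_tildeElt (g : G) (a k m : ℕ) :
    geomSum (g ^ a) k ^ m * tildeElt g = ((k : ℤ) ^ m) • tildeElt g := by
  induction m with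
  | zero => simp
  | succ m ih => rw [pow_succ, mul_assoc, geomSum_mul_tildeElt, mul_smul_comm, ih, smul_smul,
      pow_succ, mul_comm]

theorem geomSum_mul_geomSum (g : G) (k l : ℕ) :
    geomSum g k * geomSum (g ^ k) l = geomSum g (k * l) := by
  induction l with
  | zero => simp [geomSum]
  | succ l ih =>
    have h1 : geomSum (g ^ k) (l + 1) = geomSum (g ^ k) l + MonoidAlgebra.of ℤ G ((g ^ k) ^ l) :=
      Finset.sum_range_succ _ _
    have h2 : geomSum g (k * (l + 1)) =
        geomSum g (k * l) + geomSum g k * MonoidAlgebra.of ℤ G ((g ^ k) ^ l) := by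
      simp only [geomSum, Nat.mul_succ, Finset.sum_range_add, Finset.sum_mul, ← map_mul]
      congr 1
      refine Finset.sum_congr rfl fun i _ => ?_
      rw [← pow_mul, ← pow_add, add_comm]
    rw [h1, mul_add, ih, h2]

theorem commute_geomSum (g : G) (k i l : ℕ) : Commute (geomSum g k) (geomSum (g ^ i) l) := by
  refine Commute.sum_left _ _ _ fun a _ => Commute.sum_right _ _ _ fun b _ => ?_
  change _ * _ = _ * _
  rw [← map_mul, ← map_mul, ← pow_mul, ← pow_add, ← pow_add, add_comm]

theorem geomSum_order_mul_add_one (g : G) (q : ℕ) :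
    geomSum g (orderOf g * q + 1) = 1 + (q : ℤ) • tildeElt g := by
  have h1 : geomSum g (orderOf g * q + 1) =
      geomSum g (orderOf g * q) + MonoidAlgebra.of ℤ G (g ^ (orderOf g * q)) :=
    Finset.sum_range_succ _ _
  have h2 : geomSum (1 : G) q = (q : ℤ) • 1 := by
    simp only [geomSum, one_pow, map_one, Finset.sum_const, Finset.card_range, natCast_zsmul]
  rw [h1, ← geomSum_mul_geomSum, pow_mul, pow_orderOf_eq_one, one_pow, map_one, h2,
    mul_smul_comm, mul_one, add_comm, tildeElt]

theorem tildeElt_mul_tildeElt (g : G) :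
    tildeElt g * tildeElt g = (orderOf g : ℤ) • tildeElt g := by
  have h := geomSum_mul_tildeElt g 1 (orderOf g)
  rwa [pow_one] at h

theorem one_add_smul_tildeElt_pow (g : G) (q : ℤ) (m : ℕ) :
    ∃ t : ℤ, (1 + q • tildeElt g) ^ m = 1 + t • tildeElt g ∧
      1 + (orderOf g : ℤ) * t = (1 + (orderOf g : ℤ) * q) ^ m := by
  induction m with
  | zero => exact ⟨0, by simp, by simp⟩
  | succ m ih =>
    obtain ⟨t, h1, h2⟩ := ih
    refine ⟨t + q + t * q * orderOf g, ?_, by rw [pow_succ, ← h2]; ring⟩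
    rw [pow_succ, h1, mul_add, add_mul, add_mul, smul_mul_smul_comm, tildeElt_mul_tildeElt]
    simp only [one_mul, mul_one]
    module

theorem isUnit_bassElt (g : G) (hg : 0 < orderOf g) (k m : ℕ) (hk : 0 < k) (hm : 0 < m)
    (hkm : k ^ m ≡ 1 [MOD orderOf g]) : IsUnit (bassElt g k m) := by
  have hn : (orderOf g : ℤ) ≠ 0 := by exact_mod_cast hg.ne'
  have key : ∀ a : ℕ, 0 < a → a ≡ 1 [MOD orderOf g] → ∃ q : ℕ, a = orderOf g * q + 1 := by
    intro a ha h
    obtain ⟨q, hq⟩ := (Nat.modEq_iff_dvd' ha).1 h.symm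
    exact ⟨q, by omega⟩
  obtain ⟨q, hq⟩ := key _ (pow_pos hk m) hkm
  set l := k ^ (m - 1) with hl
  have hkl : k * l = k ^ m := by rw [hl, ← pow_succ', Nat.sub_add_cancel hm]
  have hlm : l ^ m ≡ 1 [MOD orderOf g] := by
    have := hkm.pow (m - 1)
    rwa [one_pow, ← pow_mul, mul_comm, pow_mul] at this
  obtain ⟨q', hq'⟩ := key _ (pow_pos (pow_pos hk _) m) hlm
  have hqz : (k : ℤ) ^ m = orderOf g * q + 1 := by exact_mod_cast hq
  have hqz' : (l : ℤ) ^ m = orderOf g * q' + 1 := by exact_mod_cast hq'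
  have hc : (1 - (k : ℤ) ^ m) / (orderOf g : ℤ) = -q := by
    rw [hqz]
    apply Int.ediv_eq_of_eq_mul_right hn
    ring
  obtain ⟨t, ht1, ht2⟩ := one_add_smul_tildeElt_pow g q m
  have ht : t = q + q' + orderOf g * q * q' := by
    apply mul_left_cancel₀ hn
    have h1 : (1 + (orderOf g : ℤ) * q) ^ m = (k : ℤ) ^ m * (l : ℤ) ^ m := by
      rw [← mul_pow, add_comm, ← hqz]
      exact_mod_cast congrArg (· ^ m) hkl.symm
    rw [h1, hqz, hqz'] at ht2
    linear_combination ht2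
  have hPQ : geomSum g k ^ m * geomSum (g ^ k) l ^ m = 1 + t • tildeElt g := by
    rw [← (commute_geomSum g k k l).mul_pow, geomSum_mul_geomSum, hkl, hq,
      geomSum_order_mul_add_one, ht1]
  have hPS : geomSum g k ^ m * tildeElt g = ((k : ℤ) ^ m) • tildeElt g := by
    have h := geomSum_pow_mul_tildeElt g 1 k m
    rwa [pow_one] at h
  have hQS := geomSum_pow_mul_tildeElt g k l m
  have cPQ : Commute (geomSum g k ^ m) (geomSum (g ^ k) l ^ m) :=
    (commute_geomSum g k k l).pow_pow m m
  have cPS : Commute (geomSum g k ^ m) (tildeElt g) := by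
    have h := commute_geomSum g k 1 (orderOf g)
    rw [pow_one] at h
    exact h.pow_left m
  have cSQ : Commute (tildeElt g) (geomSum (g ^ k) l ^ m) :=
    (commute_geomSum g (orderOf g) k l).pow_right m
  have huv : bassElt g k m * (geomSum (g ^ k) l ^ m + (-(q' : ℤ)) • tildeElt g) = 1 := by
    rw [bassElt, hc, mul_add, add_mul, add_mul, hPQ, mul_smul_comm, hPS, smul_mul_assoc,
      cSQ.eq, hQS, smul_mul_smul_comm, tildeElt_mul_tildeElt, hqz, hqz', ht]
    module
  have hcomm : Commute (bassElt g k m) (geomSum (g ^ k) l ^ m + (-(q' : ℤ)) • tildeElt g) := by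
    rw [bassElt]
    exact ((cPQ.add_right (cPS.smul_right _)).add_left
      ((cSQ.add_right ((Commute.refl _).smul_right _)).smul_left _))
  exact ⟨⟨_, _, huv, hcomm.eq ▸ huv⟩, rfl⟩

end Checks

/-- For a homomorphism `f` to `D₈ = ⟨a, b ∣ a⁴ = b² = 1, ba = a³b⟩`: at least two of the elements
`b, ab, a²b, a³b` do not have a preimage of order `2`. Here `a = r 1` and `b = sr 0`. -/
def AtLeastTwoWithoutInvolutiveLift {G : Type*} [Group G] (f : G →* DihedralGroup 4) : Prop :=
  let a : DihedralGroup 4 := DihedralGroup.r 1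
  let b : DihedralGroup 4 := DihedralGroup.sr 0
  2 ≤ {y | y ∈ ({b, a * b, a ^ 2 * b, a ^ 3 * b} : Set (DihedralGroup 4)) ∧
    ¬ ∃ g : G, f g = y ∧ orderOf g = 2}.ncard

/-- The action of the cyclic group of order `n` whose generator acts as the automorphism `α`. -/
def cyclicAction {N : Type*} [Group N] (n : ℕ) [NeZero n] (α : MulAut N) (hα : α ^ n = 1) :
    Multiplicative (ZMod n) →* MulAut N where
  toFun x := α ^ (Multiplicative.toAdd x).val
  map_one' := by simp
  map_mul' x y := by
    rw [toAdd_mul, ZMod.val_add, ← pow_eq_pow_mod _ hα, pow_add]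

open FreeGroup in
/-- The group `⟨a, b ∣ a⁸ = 1, b² = 1, ba = a³b⟩`; here `a = of 0` and `b = of 1`. -/
abbrev SemidihedralGroup16 : Type :=
  PresentedGroup ({of 0 ^ 8, of 1 ^ 2, (of 1 * of 0) * (of 0 ^ 3 * of 1)⁻¹} :
    Set (FreeGroup (Fin 2)))

/-- The group `C₄ ⋊ C₄`, the generator of the right factor acting by inversion. -/
abbrev C4SemidirectC4 : Type :=
  Multiplicative (ZMod 4) ⋊[cyclicAction 4 (MulEquiv.inv (Multiplicative (ZMod 4)))
    (by ext x; revert x; decide)] Multiplicative (ZMod 4)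

/-- The automorphism of `⟨z⟩₂ × ⟨a⟩₄` which fixes `z` and maps `a` to `za`, that is, which maps
`zⁱaʲ` to `zⁱ⁺ʲaʲ`. -/
def twistAut : MulAut (Multiplicative (ZMod 2) × Multiplicative (ZMod 4)) where
  toFun x := (x.1 * Multiplicative.ofAdd (ZMod.cast x.2.toAdd : ZMod 2), x.2)
  invFun x := (x.1 * Multiplicative.ofAdd (ZMod.cast x.2.toAdd : ZMod 2), x.2)
  left_inv := by decide
  right_inv := by decide
  map_mul' := by decide

/-- The group `(⟨z⟩₂ × ⟨a⟩₄) ⋊ ⟨b⟩₂` with `z` central and `b⁻¹ab = za`. -/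
abbrev C2C4SemidirectC2 : Type :=
  (Multiplicative (ZMod 2) × Multiplicative (ZMod 4)) ⋊[cyclicAction 2 twistAut
    (by ext x <;> revert x <;> decide)] Multiplicative (ZMod 2)

/-- `G` is a finite `2`-group which has an epimorphism onto `D₈` such that at least two of
`b, ab, a²b, a³b` have no preimage of order `2`. -/
def SatisfiesLiftCondition (G : Type*) [Group G] : Prop :=
  Finite G ∧ IsPGroup 2 G ∧ ∃ f : G →* DihedralGroup 4,
    Function.Surjective f ∧ AtLeastTwoWithoutInvolutiveLift f

end GroupRingUnits

/-! Compose `f` with the faithful representation of `D₈` by signed permutation matrices to map `ℤG`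
to 2×2 integer matrices. The reflections form two conjugacy classes, `sr 0, sr 2` and `sr 1, sr 3`;
up to an outer automorphism of `D₈`, the first has no lift of order 2. Its lifts then have order
divisible by 4, so `g̃` maps to an even multiple of `1 + ρ(f g)` and the bicyclic units of `g`
become translations by multiples of 8, up to conjugation by the rotation. The other reflections give
parabolics fixing `(1, ±1)`, and Bass units give powers of the rotation
(`groupRingRep_mem_of_mem_bassBicyclicSubgroup`).

The group generated by all these matrices is too small. Ping-pong on the projective line leaves the
gap `(3, 4)` uncovered, so only `± 1` can fix the vector `(7, 2)` (`eq_one_or_neg_one_of_fixes`).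
But `ℤG` contains a square-zero element whose image is a nonzero matrix killing `(7, 2)`. Every
positive power of the corresponding unipotent unit has an image fixing `(7, 2)` and different from
`± 1`, so no such power lies in the subgroup. This is impossible for a subgroup of finite index. -/

namespace GroupRingUnits

/-! ### Reduced words in the three kinds of letters -/

/-- The rotation by a right angle. -/
def rotMat : Matrix (Fin 2) (Fin 2) ℤ := !![0, -1; 1, 0]

/-- The `n`-th power of a parabolic matrix fixing the vector `(1, 1)`. -/
def diagParabolic (n : ℤ) : Matrix (Fin 2) (Fin 2) ℤ :=
  !![1 + 2 * n, -(2 * n); 2 * n, 1 - 2 * n]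

/-- The translation by `8 * n`. -/
def translation (n : ℤ) : Matrix (Fin 2) (Fin 2) ℤ := !![1, 8 * n; 0, 1]

theorem rotMat_mul_rotMat : rotMat * rotMat = -1 := by decide

theorem diagParabolic_mul (m n : ℤ) :
    diagParabolic m * diagParabolic n = diagParabolic (m + n) := by
  ext i j
  fin_cases i <;> fin_cases j <;> simp [diagParabolic, Matrix.mul_apply, Fin.sum_univ_two] <;> ring

theorem translation_mul (m n : ℤ) : translation m * translation n = translation (m + n) := by
  ext i j
  fin_cases i <;> fin_cases j <;> simp [translation, Matrix.mul_apply, Fin.sum_univ_two] <;> ring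

theorem diagParabolic_zero : diagParabolic 0 = 1 := by decide

theorem translation_zero : translation 0 = 1 := by decide

/-- The reduced words in the rotation, the parabolic matrices fixing `(1, 1)` and the translations,
up to sign. The index tells which kind of letter comes first (`3` for the empty word). -/
inductive ReducedWord : Fin 4 → Matrix (Fin 2) (Fin 2) ℤ → Prop
  | one : ReducedWord 3 1
  | neg_one : ReducedWord 3 (-1)
  | rot {j M} : j ≠ 0 → ReducedWord j M → ReducedWord 0 (rotMat * M)
  | parabolic {j M n} : j ≠ 1 → n ≠ 0 → ReducedWord j M → ReducedWord 1 (diagParabolic n * M)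
  | translation {j M n} : j ≠ 2 → n ≠ 0 → ReducedWord j M → ReducedWord 2 (translation n * M)

/-- The sign moves through the word to its empty end; it arises because the rotation squares to
`-1`. -/
theorem ReducedWord.neg {j M} (h : ReducedWord j M) : ReducedWord j (-M) := by
  induction h with
  | one => exact .neg_one
  | neg_one => rw [neg_neg]; exact .one
  | rot hj _ ih => rw [← mul_neg]; exact .rot hj ih
  | parabolic hj hn _ ih => rw [← mul_neg]; exact .parabolic hj hn ih
  | translation hj hn _ ih => rw [← mul_neg]; exact .translation hj hn ih

theorem ReducedWord.rotMat_mul {j M} (h : ReducedWord j M) : ∃ k, ReducedWord k (rotMat * M) := by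
  by_cases hj : j = 0
  · subst hj
    cases h with
    | rot hj h =>
      rw [← mul_assoc, rotMat_mul_rotMat, neg_one_mul]
      exact ⟨_, h.neg⟩
  · exact ⟨_, .rot hj h⟩

theorem ReducedWord.diagParabolic_mul {j M} (n : ℤ) (h : ReducedWord j M) :
    ∃ k, ReducedWord k (diagParabolic n * M) := by
  by_cases hn : n = 0
  · rw [hn, diagParabolic_zero, one_mul]
    exact ⟨_, h⟩
  by_cases hj : j = 1
  · subst hj
    cases h with
    | @parabolic j M m hj hm h =>
      rw [← mul_assoc, GroupRingUnits.diagParabolic_mul]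
      by_cases hnm : n + m = 0
      · rw [hnm, diagParabolic_zero, one_mul]
        exact ⟨_, h⟩
      · exact ⟨_, .parabolic hj hnm h⟩
  · exact ⟨_, .parabolic hj hn h⟩

theorem ReducedWord.translation_mul {j M} (n : ℤ) (h : ReducedWord j M) :
    ∃ k, ReducedWord k (GroupRingUnits.translation n * M) := by
  by_cases hn : n = 0
  · rw [hn, translation_zero, one_mul]
    exact ⟨_, h⟩
  by_cases hj : j = 2
  · subst hj
    cases h with
    | @translation j M m hj hm h =>
      rw [← mul_assoc, GroupRingUnits.translation_mul]
      by_cases hnm : n + m = 0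
      · rw [hnm, translation_zero, one_mul]
        exact ⟨_, h⟩
      · exact ⟨_, .translation hj hnm h⟩
  · exact ⟨_, .translation hj hn h⟩

/-! ### Ping-pong on the projective line -/

/-- The ping-pong regions of the projective line, in terms of homogeneous coordinates: the
intervals `(-3, 1/3)`, `(1/3, 3)` and `(4, -4)`, and the point `7/2`. -/
def pingPongRegion (j : Fin 4) (x y : ℤ) : Prop :=
  match j with
  | 0 => (x + 3 * y) * (3 * x - y) < 0
  | 1 => (3 * x - y) * (x - 3 * y) < 0
  | 2 => 16 * y ^ 2 < x ^ 2
  | 3 => (x = 7 ∧ y = 2) ∨ (x = -7 ∧ y = -2)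

/-- In the coordinate `t = x / y` this is `t ↦ -1 / t`, which sends the complement of `[-3, 1/3]`
into `(-3, 1/3)`. -/
theorem pingPongRegion_rot {j : Fin 4} {x y : ℤ} (hj : j ≠ 0) (h : pingPongRegion j x y) :
    pingPongRegion 0 (-y) x := by
  fin_cases j <;> simp only [pingPongRegion] at h ⊢
  · exact absurd rfl hj
  · rcases lt_trichotomy y 0 with hy | hy | hy <;> nlinarith [sq_nonneg (x - y), sq_nonneg (x + y)]
  · nlinarith [sq_nonneg (x - 4 * y), sq_nonneg (x + 4 * y)]
  · rcases h with ⟨rfl, rfl⟩ | ⟨rfl, rfl⟩ <;> norm_num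

theorem pingPongRegion_parabolic {j : Fin 4} {x y n : ℤ} (hj : j ≠ 1) (hn : n ≠ 0)
    (h : pingPongRegion j x y) :
    pingPongRegion 1 ((1 + 2 * n) * x - 2 * n * y) (2 * n * x + (1 - 2 * n) * y) := by
  -- The other regions lie outside `[1/3, 3]`.
  have key : 0 < (3 * x - y) * (x - 3 * y) := by
    fin_cases j <;> simp only [pingPongRegion] at h
    · nlinarith [sq_nonneg (x - y), sq_nonneg (x + y)]
    · exact absurd rfl hj
    · nlinarith [sq_nonneg (x - 4 * y), sq_nonneg (x + 4 * y)]
    · rcases h with ⟨rfl, rfl⟩ | ⟨rfl, rfl⟩ <;> norm_num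
  simp only [pingPongRegion]
  -- The forms `A` and `B` vanish at the endpoints `1/3` and `3`. In these coordinates the new
  -- product is minus a quadratic form with coefficients `n ^ 2 ± n ≥ 0` and `2 * n ^ 2 - 1 > 0`.
  obtain ⟨A, hA⟩ : ∃ A, A = 3 * x - y := ⟨_, rfl⟩
  obtain ⟨B, hB⟩ : ∃ B, B = x - 3 * y := ⟨_, rfl⟩
  rw [← hA, ← hB] at key
  have h1 : 3 * ((1 + 2 * n) * x - 2 * n * y) - (2 * n * x + (1 - 2 * n) * y)
      = (1 + n) * A + n * B := by rw [hA, hB]; ring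
  have h2 : (1 + 2 * n) * x - 2 * n * y - 3 * (2 * n * x + (1 - 2 * n) * y)
      = (1 - n) * B - n * A := by rw [hA, hB]; ring
  rw [h1, h2]
  have hn2 : 1 ≤ n ^ 2 := by have := sq_pos_of_ne_zero hn; omega
  have hA2 : 0 < A ^ 2 := by
    apply sq_pos_of_ne_zero; rintro rfl; simp at key
  have hB2 : 0 < B ^ 2 := by
    apply sq_pos_of_ne_zero; rintro rfl; simp at key
  have h3 : ((1 + n) * A + n * B) * ((1 - n) * B - n * A)
      = -((n ^ 2 + n) * A ^ 2 + (n ^ 2 - n) * B ^ 2 + (2 * n ^ 2 - 1) * (A * B)) := by ring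
  have h4 : 0 ≤ n ^ 2 + n := by nlinarith [sq_nonneg (2 * n + 1)]
  have h5 : 0 ≤ n ^ 2 - n := by nlinarith [sq_nonneg (2 * n - 1)]
  rw [h3]
  have h6 : 0 < (2 * n ^ 2 - 1) * (A * B) := mul_pos (by linarith) key
  have h7 := mul_nonneg h4 hA2.le
  have h8 := mul_nonneg h5 hB2.le
  linarith

theorem pingPongRegion_translation {j : Fin 4} {x y n : ℤ} (hj : j ≠ 2) (hn : n ≠ 0)
    (h : pingPongRegion j x y) : pingPongRegion 2 (x + 8 * n * y) y := by
  -- The other regions lie in `|t| < 4`, an interval of length 8, which a nonzero multiple of 8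
  -- moves off itself.
  have key : x ^ 2 < 16 * y ^ 2 := by
    fin_cases j <;> simp only [pingPongRegion] at h
    · nlinarith [sq_nonneg (3 * x + 4 * y)]
    · nlinarith [sq_nonneg (3 * x - 5 * y)]
    · exact absurd rfl hj
    · rcases h with ⟨rfl, rfl⟩ | ⟨rfl, rfl⟩ <;> norm_num
  simp only [pingPongRegion]
  have hx : |x| < 4 * |y| := by
    have : |x| < |4 * y| := sq_lt_sq.1 (by linarith)
    rwa [abs_mul] at this
  have h1 : 8 * |y| ≤ |8 * n * y| := by
    rw [abs_mul, abs_mul]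
    have := Int.one_le_abs hn
    have h8 : |(8 : ℤ)| = 8 := rfl
    rw [h8]
    nlinarith [abs_nonneg y]
  have h2 : |8 * n * y| ≤ |x + 8 * n * y| + |x| := by
    have := abs_sub (x + 8 * n * y) x
    rwa [add_sub_cancel_left] at this
  have h3 : |4 * y| < |x + 8 * n * y| := by
    rw [abs_mul]
    have h4 : |(4 : ℤ)| = 4 := rfl
    rw [h4]; linarith
  have := sq_lt_sq.2 h3
  linarith

/-- The ping-pong induction, tracking the image of the base vector `(7, 2)` under the word. -/
theorem ReducedWord.region {j M} (h : ReducedWord j M) :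
    pingPongRegion j (7 * M 0 0 + 2 * M 0 1) (7 * M 1 0 + 2 * M 1 1) := by
  induction h with
  | one => simp [pingPongRegion]
  | neg_one => simp [pingPongRegion]
  | rot hj _ ih =>
    convert pingPongRegion_rot hj ih using 1 <;>
      simp [rotMat, Matrix.mul_apply, Fin.sum_univ_two] <;> ring
  | @parabolic j M n hj hn _ ih =>
    convert pingPongRegion_parabolic hj hn ih using 1 <;>
      simp [diagParabolic, Matrix.mul_apply, Fin.sum_univ_two] <;> ring
  | translation hj hn _ ih =>
    convert pingPongRegion_translation hj hn ih using 1 <;>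
      simp [GroupRingUnits.translation, Matrix.mul_apply, Fin.sum_univ_two] <;> ring

/-! ### The group generated by the letters -/

/-- The monoid (in fact a group) generated by the rotation, the parabolic matrices fixing `(1, 1)`
and the translations. -/
def pingPongMonoid : Submonoid (Matrix (Fin 2) (Fin 2) ℤ) :=
  Submonoid.closure ({rotMat} ∪ Set.range diagParabolic ∪ Set.range translation)

theorem rotMat_mem : rotMat ∈ pingPongMonoid :=
  Submonoid.subset_closure (.inl (.inl rfl))

theorem diagParabolic_mem (n : ℤ) : diagParabolic n ∈ pingPongMonoid :=
  Submonoid.subset_closure (.inl (.inr ⟨n, rfl⟩))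

theorem translation_mem (n : ℤ) : translation n ∈ pingPongMonoid :=
  Submonoid.subset_closure (.inr ⟨n, rfl⟩)

theorem neg_one_mem : -1 ∈ pingPongMonoid :=
  rotMat_mul_rotMat ▸ mul_mem rotMat_mem rotMat_mem

theorem neg_mem_pingPongMonoid {M} (h : M ∈ pingPongMonoid) : -M ∈ pingPongMonoid :=
  neg_one_mul M ▸ mul_mem neg_one_mem h

theorem rotMat_conj_mem {M} (h : M ∈ pingPongMonoid) :
    rotMat * M * -rotMat ∈ pingPongMonoid :=
  mul_mem (mul_mem rotMat_mem h) (neg_mem_pingPongMonoid rotMat_mem)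

theorem exists_reducedWord_of_mem {M} (h : M ∈ pingPongMonoid) : ∃ j, ReducedWord j M := by
  induction h using Submonoid.closure_induction_left with
  | one => exact ⟨_, .one⟩
  | mul_left x hx y _ ih =>
    obtain ⟨j, hj⟩ := ih
    rcases hx with (rfl | ⟨n, rfl⟩) | ⟨n, rfl⟩
    exacts [hj.rotMat_mul, hj.diagParabolic_mul n, hj.translation_mul n]

theorem exists_right_inverse_of_mem {M} (h : M ∈ pingPongMonoid) :
    ∃ N ∈ pingPongMonoid, M * N = 1 := by
  induction h using Submonoid.closure_induction_left with
  | one => exact ⟨1, one_mem _, one_mul _⟩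
  | mul_left x hx y _ ih =>
    obtain ⟨N, hN, h⟩ := ih
    suffices ∃ z ∈ pingPongMonoid, x * z = 1 by
      obtain ⟨z, hz, hxz⟩ := this
      exact ⟨N * z, mul_mem hN hz, by rw [mul_assoc, ← mul_assoc y, h, one_mul, hxz]⟩
    rcases hx with (rfl | ⟨n, rfl⟩) | ⟨n, rfl⟩
    · exact ⟨-rotMat, neg_mem_pingPongMonoid rotMat_mem, by decide⟩
    · exact ⟨_, diagParabolic_mem (-n), by
        rw [diagParabolic_mul, add_neg_cancel, diagParabolic_zero]⟩
    · exact ⟨_, translation_mem (-n), by rw [translation_mul, add_neg_cancel, translation_zero]⟩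

/-- An element of the ping-pong monoid which fixes the vector `(7, 2)` is `± 1`. -/
theorem eq_one_or_neg_one_of_fixes {M} (h : M ∈ pingPongMonoid)
    (h0 : 7 * M 0 0 + 2 * M 0 1 = 7) (h1 : 7 * M 1 0 + 2 * M 1 1 = 2) : M = 1 ∨ M = -1 := by
  obtain ⟨j, hj⟩ := exists_reducedWord_of_mem h
  have hr := hj.region
  rw [h0, h1] at hr
  -- Since `7/2` lies in none of the three intervals, the word must be empty.
  fin_cases j
  · norm_num [pingPongRegion] at hr
  · norm_num [pingPongRegion] at hr
  · norm_num [pingPongRegion] at hr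
  · cases hj with
    | one => exact .inl rfl
    | neg_one => exact .inr rfl

/-! ### The representation of `D₈` -/

/-- The faithful two-dimensional representation of the dihedral group of order `8`. -/
def dihedralRep : DihedralGroup 4 →* Matrix (Fin 2) (Fin 2) ℤ where
  toFun
    | .r i => ![1, rotMat, -1, -rotMat] i
    | .sr i => ![!![1, 0; 0, -1], !![0, -1; -1, 0], !![-1, 0; 0, 1], !![0, 1; 1, 0]] i
  map_one' := rfl
  map_mul' := by
    rintro (i | i) (j | j) <;> revert i j <;> decide

theorem dihedralRep_sq (d : DihedralGroup 4) :
    (dihedralRep d * dihedralRep d = 1 ∨ dihedralRep d * dihedralRep d = -1) := by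
  rcases d with i | i <;> revert i <;> decide

theorem dihedralRep_mem_of_sq {d : DihedralGroup 4}
    (h : dihedralRep d * dihedralRep d = -1) : dihedralRep d ∈ pingPongMonoid := by
  have : dihedralRep d = rotMat ∨ dihedralRep d = -rotMat := by
    revert h
    rcases d with i | i <;> revert i <;> decide
  rcases this with h | h
  · exact h ▸ rotMat_mem
  · exact h ▸ neg_mem_pingPongMonoid rotMat_mem

/-- Here `1 ± ρ(d)` are twice the two coordinate projections, so `X` is 4 times an off-diagonal
entry of `ρ(e)`. -/
theorem dihedralRep_reflection_even {d : DihedralGroup 4} (hd : d = .sr 0 ∨ d = .sr 2)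
    (e : DihedralGroup 4) (X : Matrix (Fin 2) (Fin 2) ℤ)
    (hX : X = (1 - dihedralRep d) * dihedralRep e * (1 + dihedralRep d) ∨
      X = (1 + dihedralRep d) * dihedralRep e * (1 - dihedralRep d)) :
    X = 0 ∨ X = !![0, 4; 0, 0] ∨ X = !![0, -4; 0, 0] ∨ X = !![0, 0; 4, 0] ∨ X = !![0, 0; -4, 0] := by
  rcases hX with rfl | rfl <;> rcases hd with rfl | rfl <;> rcases e with i | i <;> revert i <;>
    decide

/-- The eigenlines of `ρ(d)` are spanned by `(1, 1)` and `(1, -1)`; a nonzero `X` has one of them as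
both kernel and image. -/
theorem dihedralRep_reflection_odd {d : DihedralGroup 4} (hd : d = .sr 1 ∨ d = .sr 3)
    (e : DihedralGroup 4) (X : Matrix (Fin 2) (Fin 2) ℤ)
    (hX : X = (1 - dihedralRep d) * dihedralRep e * (1 + dihedralRep d) ∨
      X = (1 + dihedralRep d) * dihedralRep e * (1 - dihedralRep d)) :
    X = 0 ∨ X = !![2, -2; 2, -2] ∨ X = !![-2, 2; -2, 2] ∨ X = !![2, 2; -2, -2] ∨
      X = !![-2, -2; 2, 2] := by
  rcases hX with rfl | rfl <;> rcases hd with rfl | rfl <;> rcases e with i | i <;> revert i <;>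
    decide

theorem dihedralRep_center {d : DihedralGroup 4} (hd : d = .r 0 ∨ d = .r 2)
    (e : DihedralGroup 4) (X : Matrix (Fin 2) (Fin 2) ℤ)
    (hX : X = (1 - dihedralRep d) * dihedralRep e * (1 + dihedralRep d) ∨
      X = (1 + dihedralRep d) * dihedralRep e * (1 - dihedralRep d)) : X = 0 := by
  rcases hX with rfl | rfl <;> rcases hd with rfl | rfl <;> rcases e with i | i <;> revert i <;>
    decide

/-! ### Geometric sums of elements with square `± 1` -/

section RingLemmas

variable {R : Type*} [Ring R]

theorem geom_sum_even_of_sq {x : R} (hx : x * x = 1) (q : ℕ) :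
    ∑ i ∈ Finset.range (2 * q), x ^ i = (q : ℤ) • (1 + x) := by
  induction q with
  | zero => simp
  | succ q ih =>
    rw [Nat.mul_succ, Finset.sum_range_succ, Finset.sum_range_succ, ih, pow_succ, pow_mul, sq, hx,
      one_pow, one_mul]
    push_cast
    module

theorem geom_sum_odd_of_sq {x : R} (hx : x * x = 1) (l : ℕ) :
    ∑ i ∈ Finset.range (2 * l + 1), x ^ i = 1 + (l : ℤ) • (1 + x) := by
  rw [Finset.sum_range_succ, geom_sum_even_of_sq hx, pow_mul, sq, hx, one_pow, add_comm]

/-- Because `(1 + x) ^ 2 = 2 (1 + x)`, such elements multiply like the numbers `1 + 2 l` obtained by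
putting `x = 1`. -/
theorem one_add_smul_pow_of_sq {x : R} (hx : x * x = 1) (l : ℤ) (m : ℕ) :
    ∃ t : ℤ, (1 + l • (1 + x)) ^ m = 1 + t • (1 + x) ∧ 1 + 2 * t = (1 + 2 * l) ^ m := by
  induction m with
  | zero => exact ⟨0, by simp, by simp⟩
  | succ m ih =>
    obtain ⟨t, h1, h2⟩ := ih
    refine ⟨t + l + 2 * t * l, ?_, by rw [pow_succ, ← h2]; ring⟩
    have hE : (1 + x) * (1 + x) = (2 : ℤ) • (1 + x) := by
      rw [mul_add, add_mul, add_mul, hx]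
      simp only [one_mul, mul_one]
      module
    rw [pow_succ, h1, mul_add, add_mul, add_mul, smul_mul_smul_comm, hE]
    simp only [one_mul, mul_one]
    module

theorem geom_sum_odd_of_sq_eq_neg_one {x : R} (hx : x * x = -1) (l : ℕ) :
    ∑ i ∈ Finset.range (2 * l + 1), x ^ i = 1 ∨ ∑ i ∈ Finset.range (2 * l + 1), x ^ i = x := by
  suffices (∑ i ∈ Finset.range (2 * l + 1), x ^ i = 1 ∧ x ^ (2 * l) = 1) ∨
      (∑ i ∈ Finset.range (2 * l + 1), x ^ i = x ∧ x ^ (2 * l) = -1) from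
    this.imp And.left And.left
  induction l with
  | zero => simp
  | succ l ih =>
    rw [Nat.mul_succ, Finset.sum_range_succ, Finset.sum_range_succ, pow_add x (2 * l) 2, sq, hx,
      pow_succ x (2 * l)]
    rcases ih with ⟨h1, h2⟩ | ⟨h1, h2⟩
    · exact .inr (by simp [h1, h2])
    · exact .inl (by simp [h1, h2])

end RingLemmas

/-! ### Images of the Bass and bicyclic units -/

section GroupRing

variable {G : Type*} [Group G]

/-- The linear extension to `ℤG` of the two-dimensional representation of `D₈`, pulled back along
`f : G → D₈`. -/
noncomputable def groupRingRep (f : G →* DihedralGroup 4) :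
    MonoidAlgebra ℤ G →ₐ[ℤ] Matrix (Fin 2) (Fin 2) ℤ :=
  MonoidAlgebra.lift ℤ (Matrix (Fin 2) (Fin 2) ℤ) G (dihedralRep.comp f)

variable (f : G →* DihedralGroup 4)

theorem groupRingRep_of (g : G) :
    groupRingRep f (MonoidAlgebra.of ℤ G g) = dihedralRep (f g) := by
  rw [groupRingRep, MonoidAlgebra.lift_of]
  rfl

theorem groupRingRep_geomSum (g : G) (k : ℕ) :
    groupRingRep f (geomSum g k) = ∑ i ∈ Finset.range k, dihedralRep (f g) ^ i := by
  simp only [geomSum, map_sum, groupRingRep_of, map_pow]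

theorem eq_one_or_even_orderOf [Finite G] (hG : IsPGroup 2 G) (g : G) :
    g = 1 ∨ ∃ q, orderOf g = 2 * q := by
  obtain ⟨s, hs⟩ := (IsPGroup.iff_orderOf.1 hG) g
  rcases s with _ | s
  · exact .inl (orderOf_eq_one_iff.1 (by simpa using hs))
  · exact .inr ⟨2 ^ s, by rw [hs, pow_succ']⟩

theorem four_dvd_orderOf [Finite G] (hG : IsPGroup 2 G) {g : G} (h1 : g ≠ 1)
    (h2 : orderOf g ≠ 2) : ∃ q, orderOf g = 2 * (2 * q) := by
  obtain ⟨s, hs⟩ := (IsPGroup.iff_orderOf.1 hG) g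
  rcases s with _ | _ | s
  · exact absurd (orderOf_eq_one_iff.1 (by simpa using hs)) h1
  · exact absurd (by simpa using hs) h2
  · exact ⟨2 ^ s, by rw [hs, pow_succ', pow_succ']⟩

theorem groupRingRep_tildeElt_of_sq_eq_neg_one {g : G}
    (hs : dihedralRep (f g) * dihedralRep (f g) = -1) : groupRingRep f (tildeElt g) = 0 := by
  rw [tildeElt, groupRingRep_geomSum]
  have h := mul_geom_sum (dihedralRep (f g)) (orderOf g)
  rw [← map_pow, ← map_pow, pow_orderOf_eq_one, map_one, map_one, sub_self] at h
  have h2 : (2 : ℤ) • ∑ i ∈ Finset.range (orderOf g), dihedralRep (f g) ^ i = 0 := by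
    -- The factor `ρ(f g) - 1`, which annihilates the sum, divides 2.
    have h3 : (-dihedralRep (f g) - 1) * (dihedralRep (f g) - 1) =
        (2 : ℤ) • (1 : Matrix (Fin 2) (Fin 2) ℤ) := by
      rw [sub_mul, mul_sub, neg_mul, hs]
      noncomm_ring
    calc _ = (-dihedralRep (f g) - 1) * (dihedralRep (f g) - 1) *
          ∑ i ∈ Finset.range (orderOf g), dihedralRep (f g) ^ i := by rw [h3, smul_one_mul]
      _ = 0 := by rw [mul_assoc, h, mul_zero]
  exact (smul_eq_zero.1 h2).resolve_left two_ne_zero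

/-- If `ρ(f g)` squares to 1, the correction term makes the image exactly 1. If it squares to `-1`,
then `g̃` maps to 0 and, `k` being odd, the geometric sum is 1 or a quarter turn. -/
theorem groupRingRep_bassElt_mem [Finite G] (hG : IsPGroup 2 G) (g : G) {k m : ℕ}
    (hk : k.Coprime (orderOf g)) (hkm : k ^ m ≡ 1 [MOD orderOf g]) :
    groupRingRep f (bassElt g k m) ∈ pingPongMonoid := by
  have hdiv : ∃ c : ℤ, 1 - (k : ℤ) ^ m = orderOf g * c := by
    have := (Nat.modEq_iff_dvd.1 hkm)
    push_cast at this
    exact this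
  obtain ⟨c, hc⟩ := hdiv
  have hn : (orderOf g : ℤ) ≠ 0 := by exact_mod_cast (orderOf_pos g).ne'
  rw [bassElt, Int.ediv_eq_of_eq_mul_right hn hc, map_add, map_pow, map_zsmul, tildeElt,
    groupRingRep_geomSum, groupRingRep_geomSum]
  rcases eq_one_or_even_orderOf hG g with rfl | ⟨q, hq⟩
  · rw [orderOf_one] at hc ⊢
    convert one_mem pingPongMonoid using 1
    simp only [map_one, one_pow, Finset.sum_const, Finset.card_range, one_smul]
    rw [← show 1 - (k : ℤ) ^ m = c by simpa using hc]
    simp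
  have hodd : ∃ l, k = 2 * l + 1 := by
    rw [hq] at hk
    exact (Nat.Coprime.coprime_mul_right_right hk).odd_of_right
  obtain ⟨l, rfl⟩ := hodd
  rcases dihedralRep_sq (f g) with hs | hs
  · obtain ⟨t, ht1, ht2⟩ := one_add_smul_pow_of_sq hs l m
    rw [hq, geom_sum_even_of_sq hs, geom_sum_odd_of_sq hs, ht1, smul_smul, add_assoc, ← add_smul]
    have : t + c * q = 0 := by
      rw [hq] at hc
      push_cast at hc
      have h3 : (1 + 2 * (l : ℤ)) ^ m = (2 * l + 1) ^ m := by ring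
      linarith
    rw [this, zero_smul, add_zero]
    exact one_mem _
  · have h0 : ∑ i ∈ Finset.range (orderOf g), dihedralRep (f g) ^ i = 0 := by
      rw [← groupRingRep_geomSum, ← tildeElt, groupRingRep_tildeElt_of_sq_eq_neg_one f hs]
    rw [h0, smul_zero, add_zero]
    rcases geom_sum_odd_of_sq_eq_neg_one hs l with h | h
    · rw [h, one_pow]
      exact one_mem _
    · rw [h]
      exact pow_mem (dihedralRep_mem_of_sq hs) m

/-- The rotation exchanges the two diagonal lines, hence conjugates the two families of parabolics.
-/
theorem one_add_smul_mem {X : Matrix (Fin 2) (Fin 2) ℤ} (q : ℤ)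
    (hX : X = 0 ∨ X = !![2, -2; 2, -2] ∨ X = !![-2, 2; -2, 2] ∨ X = !![2, 2; -2, -2] ∨
      X = !![-2, -2; 2, 2]) : 1 + q • X ∈ pingPongMonoid := by
  rcases hX with rfl | rfl | rfl | rfl | rfl
  · simp
  · convert diagParabolic_mem q using 1
    ext i j; fin_cases i <;> fin_cases j <;> simp [diagParabolic] <;> ring
  · convert diagParabolic_mem (-q) using 1
    ext i j; fin_cases i <;> fin_cases j <;> simp [diagParabolic] <;> ring
  · convert rotMat_conj_mem (diagParabolic_mem (-q)) using 1
    ext i j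
    fin_cases i <;> fin_cases j <;>
      simp [diagParabolic, rotMat, Matrix.mul_apply, Fin.sum_univ_two] <;> ring
  · convert rotMat_conj_mem (diagParabolic_mem q) using 1
    ext i j
    fin_cases i <;> fin_cases j <;>
      simp [diagParabolic, rotMat, Matrix.mul_apply, Fin.sum_univ_two] <;> ring

theorem one_add_two_mul_smul_mem {X : Matrix (Fin 2) (Fin 2) ℤ} (q : ℤ)
    (hX : X = 0 ∨ X = !![0, 4; 0, 0] ∨ X = !![0, -4; 0, 0] ∨ X = !![0, 0; 4, 0] ∨
      X = !![0, 0; -4, 0]) : 1 + (2 * q) • X ∈ pingPongMonoid := by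
  rcases hX with rfl | rfl | rfl | rfl | rfl
  · simp
  · convert translation_mem q using 1
    ext i j; fin_cases i <;> fin_cases j <;> simp [translation] <;> ring
  · convert translation_mem (-q) using 1
    ext i j; fin_cases i <;> fin_cases j <;> simp [translation] <;> ring
  · convert rotMat_conj_mem (translation_mem (-q)) using 1
    ext i j
    fin_cases i <;> fin_cases j <;>
      simp [translation, rotMat, Matrix.mul_apply, Fin.sum_univ_two] <;> ring
  · convert rotMat_conj_mem (translation_mem q) using 1
    ext i j
    fin_cases i <;> fin_cases j <;>
      simp [translation, rotMat, Matrix.mul_apply, Fin.sum_univ_two] <;> ring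

theorem groupRingRep_bicyclic_mem [Finite G] (hG : IsPGroup 2 G)
    (hf : ∀ g, f g = .sr 0 ∨ f g = .sr 2 → orderOf g ≠ 2) (g h : G) :
    groupRingRep f (bicyclicEltRight h g) ∈ pingPongMonoid ∧
      groupRingRep f (bicyclicEltLeft g h) ∈ pingPongMonoid := by
  simp only [bicyclicEltRight, bicyclicEltLeft, map_add, map_mul, map_sub, map_one,
    groupRingRep_of]
  rcases dihedralRep_sq (f g) with hs | hs
  · rcases eq_one_or_even_orderOf hG g with rfl | ⟨q, hq⟩
    · simp
    rw [tildeElt, groupRingRep_geomSum, hq, geom_sum_even_of_sq hs, mul_smul_comm,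
      smul_mul_assoc, smul_mul_assoc]
    by_cases h02 : f g = .sr 0 ∨ f g = .sr 2
    · have h1 : g ≠ 1 := by
        rintro rfl
        rw [map_one] at h02
        revert h02
        decide
      -- The only use of the lifting hypothesis: the extra factor 2 turns translations by 4 into
      -- translations by 8.
      obtain ⟨p, hp⟩ := four_dvd_orderOf hG h1 (hf g h02)
      have : (q : ℤ) = 2 * p := by omega
      rw [this]
      exact ⟨one_add_two_mul_smul_mem _ (dihedralRep_reflection_even h02 (f h) _ (.inl rfl)),
        one_add_two_mul_smul_mem _ (dihedralRep_reflection_even h02 (f h) _ (.inr rfl))⟩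
    · have h13 : (f g = .r 0 ∨ f g = .r 2) ∨ (f g = .sr 1 ∨ f g = .sr 3) := by
        revert hs h02
        generalize f g = d
        rcases d with i | i <;> revert i <;> decide
      rcases h13 with h13 | h13
      · rw [dihedralRep_center h13 (f h) _ (.inl rfl), dihedralRep_center h13 (f h) _ (.inr rfl)]
        simp
      · exact ⟨one_add_smul_mem _ (dihedralRep_reflection_odd h13 (f h) _ (.inl rfl)),
          one_add_smul_mem _ (dihedralRep_reflection_odd h13 (f h) _ (.inr rfl))⟩
  · rw [groupRingRep_tildeElt_of_sq_eq_neg_one f hs]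
    simp

theorem groupRingRep_mem_of_mem_bassBicyclicSubgroup [Finite G] (hG : IsPGroup 2 G)
    (hf : ∀ g, f g = .sr 0 ∨ f g = .sr 2 → orderOf g ≠ 2) {u : (MonoidAlgebra ℤ G)ˣ}
    (hu : u ∈ bassBicyclicSubgroup G) : groupRingRep f u ∈ pingPongMonoid := by
  induction hu using Subgroup.closure_induction with
  | mem u hu =>
    rcases hu with ⟨g, k, m, -, -, hk, hkm, hu⟩ | ⟨g, h, hu | hu⟩
    · exact hu ▸ groupRingRep_bassElt_mem f hG g hk hkm
    · exact hu ▸ (groupRingRep_bicyclic_mem f hG hf g h).1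
    · exact hu ▸ (groupRingRep_bicyclic_mem f hG hf g h).2
  | one => simp
  | mul u v _ _ hu hv =>
    rw [Units.val_mul, map_mul]
    exact mul_mem hu hv
  | inv u _ hu =>
    obtain ⟨N, hN, h⟩ := exists_right_inverse_of_mem hu
    have h2 : groupRingRep f ↑u⁻¹ * groupRingRep f u = 1 := by
      rw [← map_mul, Units.inv_mul, map_one]
    rwa [left_inv_eq_right_inv h2 h]

/-! ### A unipotent unit with no positive power in the subgroup -/

/-- The coefficients of a nilpotent element of `ℤD₈`. -/
def nilpotentCoeff : DihedralGroup 4 → ℤ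
  | .r i => ![0, 53, 0, -53] i
  | .sr i => ![28, 45, -28, -45] i

theorem sum_comp_of_surjective [Fintype G] {H : Type*} [Group H] [Fintype H]
    {f : G →* H} (hf : Function.Surjective f) :
    ∃ N : ℕ, N ≠ 0 ∧ ∀ {M : Type} [AddCommMonoid M] (F : H → M),
      ∑ g, F (f g) = N • ∑ d, F d := by
  classical
  refine ⟨(Finset.univ.filter fun g => f g = 1).card, ?_, fun F => ?_⟩
  · rw [Finset.card_ne_zero]
    exact ⟨1, by simp⟩
  · rw [← Finset.sum_fiberwise Finset.univ f, Finset.smul_sum]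
    refine Finset.sum_congr rfl fun d _ => ?_
    rw [Finset.sum_congr rfl fun g hg => by rw [(Finset.mem_filter.1 hg).2], Finset.sum_const,
      MonoidHom.card_fiber_eq_of_mem_range f (hf d) (hf 1)]

/-- The preimage in `ℤG` of a nilpotent element of `ℤD₈`. -/
noncomputable def nilpotentElt [Fintype G] : MonoidAlgebra ℤ G :=
  ∑ g, nilpotentCoeff (f g) • MonoidAlgebra.of ℤ G g

/-- The coefficients change sign under the central element `r 2`, so all linear characters vanish;
in the two-dimensional representation the square is zero because `53 ^ 2 = 28 ^ 2 + 45 ^ 2`. -/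
theorem nilpotentCoeff_conv (e : DihedralGroup 4) :
    ∑ d, nilpotentCoeff d * nilpotentCoeff (d⁻¹ * e) = 0 := by
  rcases e with i | i <;> revert i <;> decide

theorem nilpotentElt_mul_self [Fintype G] (hf : Function.Surjective f) :
    nilpotentElt f * nilpotentElt f = 0 := by
  obtain ⟨N, -, hN⟩ := sum_comp_of_surjective hf
  have h (g : G) : ∑ h, (nilpotentCoeff (f g) • MonoidAlgebra.of ℤ G g) *
        (nilpotentCoeff (f h) • MonoidAlgebra.of ℤ G h) =
      ∑ h, (nilpotentCoeff (f g) * nilpotentCoeff ((f g)⁻¹ * f h)) • MonoidAlgebra.of ℤ G h := by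
    refine Fintype.sum_equiv (Equiv.mulLeft g) _ _ fun h => ?_
    rw [smul_mul_smul_comm, ← map_mul, Equiv.coe_mulLeft, map_mul f, inv_mul_cancel_left]
  rw [nilpotentElt, Finset.sum_mul_sum, Finset.sum_congr rfl fun g _ => h g, Finset.sum_comm]
  refine Finset.sum_eq_zero fun h _ => ?_
  rw [← Finset.sum_smul, hN fun d => nilpotentCoeff d * nilpotentCoeff (d⁻¹ * f h),
    nilpotentCoeff_conv, smul_zero, zero_smul]

/-- The matrix is 4 times the column `(7, 2)` times the row `(2, -7)`, so it kills `(7, 2)`. -/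
theorem groupRingRep_nilpotentElt [Fintype G] (hf : Function.Surjective f) :
    ∃ N : ℕ, N ≠ 0 ∧ groupRingRep f (nilpotentElt f) = N • !![56, -196; 16, -56] := by
  obtain ⟨N, hN0, hN⟩ := sum_comp_of_surjective hf
  refine ⟨N, hN0, ?_⟩
  simp only [nilpotentElt, map_sum, map_zsmul, groupRingRep_of]
  rw [hN fun d => nilpotentCoeff d • dihedralRep d]
  congr 1
  decide

theorem one_add_pow_of_mul_self {R : Type*} [Ring R] {x : R} (h : x * x = 0) (k : ℕ) :
    (1 + x) ^ k = 1 + k • x := by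
  induction k with
  | zero => simp
  | succ k ih =>
    rw [pow_succ, ih, add_mul, mul_add, mul_add, smul_mul_assoc k x x, h]
    simp only [smul_zero, mul_one, one_mul, add_zero, succ_nsmul]
    abel

theorem not_finiteIndex_of_reflection [Finite G] (hG : IsPGroup 2 G)
    (hs : Function.Surjective f) (hf : ∀ g, f g = .sr 0 ∨ f g = .sr 2 → orderOf g ≠ 2) :
    ¬ (bassBicyclicSubgroup G).FiniteIndex := by
  intro hfin
  have := Fintype.ofFinite G
  obtain ⟨u, hu⟩ := isUnit_one_add_of_sq _ (nilpotentElt_mul_self f hs)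
  obtain ⟨k, hk, -, hmem⟩ := Subgroup.exists_pow_mem_of_index_ne_zero hfin.index_ne_zero u
  obtain ⟨N, hN0, hN⟩ := groupRingRep_nilpotentElt f hs
  have h := groupRingRep_mem_of_mem_bassBicyclicSubgroup f hG hf hmem
  rw [Units.val_pow_eq_pow_val, hu, one_add_pow_of_mul_self (nilpotentElt_mul_self f hs),
    map_add, map_one, map_nsmul, hN, smul_smul] at h
  have hkN : ((k * N : ℕ) : ℤ) ≠ 0 := by exact_mod_cast mul_ne_zero hk.ne' hN0
  generalize k * N = c at h hkN
  rcases eq_one_or_neg_one_of_fixes h (by simp; ring) (by simp; ring) with h | h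
  -- The upper right entry is `-196 c`, whereas `± 1` has 0 there.
  all_goals
    have := congrFun (congrFun h 0) 1
    simp at this
    exact hkN (by exact_mod_cast this)

end GroupRing

/-! ### Reduction to one class of reflections -/

/-- The outer automorphism of `D₈` which fixes the rotations and shifts the reflections. -/
def shiftReflections : DihedralGroup 4 →* DihedralGroup 4 where
  toFun
    | .r i => .r i
    | .sr i => .sr (i + 1)
  map_one' := rfl
  map_mul' := by
    rintro (i | i) (j | j) <;> revert i j <;> decide

theorem shiftReflections_surjective : Function.Surjective shiftReflections := by
  rintro (i | i)
  · exact ⟨.r i, rfl⟩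
  · exact ⟨.sr (i - 1), congrArg _ (sub_add_cancel i 1)⟩

theorem setOf_reflections :
    ({.sr 0, .r 1 * .sr 0, .r 1 ^ 2 * .sr 0, .r 1 ^ 3 * .sr 0} : Set (DihedralGroup 4)) =
      {.sr 0, .sr 3, .sr 2, .sr 1} := rfl

/-- Reflections of the same type are conjugate, so have involutive lifts simultaneously. -/
theorem exists_lift_add_two {G : Type*} [Group G] {f : G →* DihedralGroup 4}
    (hf : Function.Surjective f) {i : ZMod 4} (h : ∃ g, f g = .sr i ∧ orderOf g = 2) :
    ∃ g, f g = .sr (i + 2) ∧ orderOf g = 2 := by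
  obtain ⟨g, hg, ho⟩ := h
  obtain ⟨c, hc⟩ := hf (.r 1)
  refine ⟨c * g * c⁻¹, ?_, ?_⟩
  · rw [map_mul, map_mul, map_inv, hg, hc]
    clear hg
    revert i
    decide
  · rw [← ho]
    exact orderOf_injective (MulAut.conj c).toMonoidHom (MulAut.conj c).injective g

theorem not_finiteIndex_of_lift_condition {G : Type*} [Group G] [Finite G] (hG : IsPGroup 2 G)
    (f : G →* DihedralGroup 4) (hf : Function.Surjective f)
    (h : AtLeastTwoWithoutInvolutiveLift f) : ¬ (bassBicyclicSubgroup G).FiniteIndex := by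
  by_cases h0 : ∃ g, f g = .sr 0 ∧ orderOf g = 2
  · by_cases h1 : ∃ g, f g = .sr 1 ∧ orderOf g = 2
    · have h2 := exists_lift_add_two hf h0
      have h3 := exists_lift_add_two hf h1
      rw [AtLeastTwoWithoutInvolutiveLift] at h
      rw [setOf_reflections, (Set.ncard_eq_zero (Set.toFinite _)).2] at h
      · omega
      · rw [Set.eq_empty_iff_forall_notMem]
        rintro y ⟨rfl | rfl | rfl | rfl, hy⟩
        exacts [hy h0, hy h3, hy h2, hy h1]
    -- The outer automorphism exchanges the two classes of reflections.
    · refine not_finiteIndex_of_reflection (shiftReflections.comp f) hG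
        (shiftReflections_surjective.comp hf) fun g hg ho => h1 ?_
      have : f g = .sr 1 ∨ f g = .sr 3 := by
        revert hg
        rw [MonoidHom.comp_apply]
        generalize f g = d
        rcases d with i | i <;> revert i <;> decide
      rcases this with h | h
      · exact ⟨g, h, ho⟩
      · exact exists_lift_add_two hf ⟨g, h, ho⟩
  · refine not_finiteIndex_of_reflection f hG hf fun g hg ho => h0 ?_
    rcases hg with h | h
    · exact ⟨g, h, ho⟩
    · exact exists_lift_add_two hf ⟨g, h, ho⟩

theorem atLeastTwoWithoutInvolutiveLift_of_reflections {G : Type*} [Group G]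
    {f : G →* DihedralGroup 4}
    (h : ∀ g, f g = .sr 1 ∨ f g = .sr 3 → g ^ 2 ≠ 1) : AtLeastTwoWithoutInvolutiveLift f := by
  rw [AtLeastTwoWithoutInvolutiveLift]
  rw [setOf_reflections]
  have hne : (DihedralGroup.sr 1 : DihedralGroup 4) ≠ .sr 3 := by decide
  refine (Set.ncard_pair hne).ge.trans (Set.ncard_le_ncard ?_ (Set.toFinite _))
  rintro y (rfl | rfl)
  · refine ⟨by simp, ?_⟩
    rintro ⟨g, hg, ho⟩
    exact h g (.inl hg) (ho ▸ pow_orderOf_eq_one g)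
  · refine ⟨by simp, ?_⟩
    rintro ⟨g, hg, ho⟩
    exact h g (.inr hg) (ho ▸ pow_orderOf_eq_one g)

theorem SatisfiesLiftCondition.not_finiteIndex {G : Type*} [Group G]
    (h : SatisfiesLiftCondition G) : ¬ (bassBicyclicSubgroup G).FiniteIndex := by
  obtain ⟨_, hG, f, hf, h⟩ := h
  exact not_finiteIndex_of_lift_condition hG f hf h

theorem surjective_of_mem_range {G : Type*} [Group G] {f : G →* DihedralGroup 4}
    (ha : .r 1 ∈ f.range) (hb : .sr 0 ∈ f.range) : Function.Surjective f := by
  have hr (i : ZMod 4) : .r i ∈ f.range := by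
    have := pow_mem ha i.val
    rwa [DihedralGroup.r_pow, one_mul, ZMod.natCast_zmod_val] at this
  rintro (i | i)
  · exact hr i
  · have := mul_mem hb (hr i)
    rwa [DihedralGroup.sr_mul_r, zero_add] at this

/-! ### The four examples -/

/-- The epimorphism from the quaternion group of order `16` to `D₈`. -/
def quaternionToDihedral : QuaternionGroup 4 →* DihedralGroup 4 where
  toFun
    | .a i => .r (i.val : ZMod 4)
    | .xa i => .sr (i.val : ZMod 4)
  map_one' := rfl
  map_mul' := by
    rintro (i | i) (j | j) <;> revert i j <;> decide

/-- The only involution, `a 4`, lies in the kernel. -/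
theorem satisfiesLiftCondition_quaternionGroup : SatisfiesLiftCondition (QuaternionGroup 4) := by
  refine ⟨inferInstance, IsPGroup.of_card (n := 4) ?_, quaternionToDihedral, ?_,
    atLeastTwoWithoutInvolutiveLift_of_reflections ?_⟩
  · rw [Nat.card_eq_fintype_card, QuaternionGroup.card]
    norm_num
  · exact surjective_of_mem_range ⟨.a 1, rfl⟩ ⟨.xa 0, rfl⟩
  · rintro (i | i) <;> revert i <;> decide

/-- The epimorphism from `C₄ ⋊ C₄` to `D₈`. -/
def c4SemidirectC4ToDihedral : C4SemidirectC4 →* DihedralGroup 4 where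
  toFun x := .r x.left.toAdd * .sr 0 ^ x.right.toAdd.val
  map_one' := rfl
  map_mul' := by
    rintro ⟨i, j⟩ ⟨k, l⟩
    revert i j k l
    decide

/-- Lifts of reflections have odd right component, and their square is the involution of the right
factor. -/
theorem satisfiesLiftCondition_c4SemidirectC4 : SatisfiesLiftCondition C4SemidirectC4 := by
  have hc : Nat.card C4SemidirectC4 = 2 ^ 4 := by
    rw [SemidirectProduct.card]
    simp
  refine ⟨Nat.finite_of_card_ne_zero (by rw [hc]; norm_num), IsPGroup.of_card hc,
    c4SemidirectC4ToDihedral, ?_, atLeastTwoWithoutInvolutiveLift_of_reflections ?_⟩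
  · exact surjective_of_mem_range ⟨⟨.ofAdd 1, 1⟩, rfl⟩ ⟨⟨1, .ofAdd 1⟩, rfl⟩
  · rintro ⟨i, j⟩
    revert i j
    decide

/-- The epimorphism from `(C₂ × C₄) ⋊ C₂` to `D₈` with kernel generated by the square of the
generator of `C₄`. -/
def c2C4SemidirectC2ToDihedral : C2C4SemidirectC2 →* DihedralGroup 4 where
  toFun x := .r 2 ^ x.left.1.toAdd.val * .sr 1 ^ x.left.2.toAdd.val * .sr 0 ^ x.right.toAdd.val
  map_one' := rfl
  map_mul' := by
    rintro ⟨⟨i, j⟩, k⟩ ⟨⟨l, m⟩, n⟩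
    revert i j k l m n
    decide

/-- The lifts of `sr 1` and `sr 3` are the `zⁱa` and `zⁱa³`, with square `a² ≠ 1`. -/
theorem satisfiesLiftCondition_c2C4SemidirectC2 : SatisfiesLiftCondition C2C4SemidirectC2 := by
  have hc : Nat.card C2C4SemidirectC2 = 2 ^ 4 := by
    rw [SemidirectProduct.card]
    simp
  refine ⟨Nat.finite_of_card_ne_zero (by rw [hc]; norm_num), IsPGroup.of_card hc,
    c2C4SemidirectC2ToDihedral, ?_, atLeastTwoWithoutInvolutiveLift_of_reflections ?_⟩
  -- The product `ab` maps to `r 3`; the factor `z ↦ r 2` corrects this to `r 1`.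
  · exact surjective_of_mem_range ⟨⟨(.ofAdd 1, .ofAdd 1), .ofAdd 1⟩, by decide⟩ ⟨⟨1, .ofAdd 1⟩, rfl⟩
  · rintro ⟨⟨i, j⟩, k⟩
    revert i j k
    decide

/-! ### The semidihedral group, from its relations -/

section SemidihedralRelations

variable {G : Type*} [Group G] {a b : G}

theorem mul_pow_of_semidihedral (hab : b * a = a ^ 3 * b) (i : ℕ) :
    b * a ^ i = a ^ (3 * i) * b := by
  induction i with
  | zero => simp
  | succ i ih => rw [pow_succ, ← mul_assoc, ih, mul_assoc, hab, ← mul_assoc, ← pow_add,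
      Nat.mul_succ]

theorem sq_of_semidihedral (hb : b ^ 2 = 1) (hab : b * a = a ^ 3 * b) (i : ℕ) :
    (a ^ i * b) ^ 2 = a ^ (4 * i) := by
  rw [sq, mul_assoc, ← mul_assoc b, mul_pow_of_semidihedral hab, mul_assoc _ b, ← sq, hb, mul_one,
    ← pow_add]
  congr 1
  ring

theorem exists_normal_form_of_semidihedral (ha : a ^ 8 = 1) (hb : b ^ 2 = 1)
    (hab : b * a = a ^ 3 * b) {g : G} (hg : g ∈ Subgroup.closure {a, b}) :
    ∃ i : ℕ, g = a ^ i ∨ g = a ^ i * b := by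
  have hA (i : ℕ) (x : G) (h : ∃ i : ℕ, x = a ^ i ∨ x = a ^ i * b) :
      ∃ j : ℕ, a ^ i * x = a ^ j ∨ a ^ i * x = a ^ j * b := by
    obtain ⟨j, rfl | rfl⟩ := h
    · exact ⟨i + j, .inl (pow_add _ _ _).symm⟩
    · exact ⟨i + j, .inr (by rw [pow_add, mul_assoc])⟩
  have hB (x : G) (h : ∃ i : ℕ, x = a ^ i ∨ x = a ^ i * b) :
      ∃ j : ℕ, b * x = a ^ j ∨ b * x = a ^ j * b := by
    obtain ⟨j, rfl | rfl⟩ := h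
    · exact ⟨3 * j, .inr (mul_pow_of_semidihedral hab j)⟩
    · exact ⟨3 * j, .inl (by
        rw [← mul_assoc, mul_pow_of_semidihedral hab, mul_assoc, ← sq, hb, mul_one])⟩
  induction hg using Subgroup.closure_induction_left with
  | one => exact ⟨0, .inl (pow_zero a).symm⟩
  | mul_left x hx y _ ih =>
    rcases hx with rfl | rfl
    · simpa using hA 1 y ih
    · exact hB y ih
  | inv_mul_cancel x hx y _ ih =>
    rcases hx with rfl | rfl
    · rw [inv_eq_of_mul_eq_one_right (b := x ^ 7) (by rw [← pow_succ', ha])]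
      exact hA 7 y ih
    · rw [inv_eq_of_mul_eq_one_right (b := x) (by rw [← sq, hb])]
      exact hB y ih

theorem finite_of_semidihedral (ha : a ^ 8 = 1) (hb : b ^ 2 = 1)
    (hab : b * a = a ^ 3 * b) (hG : Subgroup.closure {a, b} = ⊤) : Finite G := by
  let F : Fin 8 × Bool → G := fun p => a ^ p.1.val * bif p.2 then b else 1
  refine Finite.of_surjective F fun g => ?_
  have hmod (i : ℕ) : a ^ (i % 8) = a ^ i := (pow_eq_pow_mod i ha).symm
  obtain ⟨i, rfl | rfl⟩ := exists_normal_form_of_semidihedral ha hb hab (hG ▸ Subgroup.mem_top g)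
  · exact ⟨(⟨i % 8, Nat.mod_lt _ (by norm_num)⟩, false), by simp [F, hmod]⟩
  · exact ⟨(⟨i % 8, Nat.mod_lt _ (by norm_num)⟩, true), by simp [F, hmod]⟩

theorem isPGroup_of_semidihedral (ha : a ^ 8 = 1) (hb : b ^ 2 = 1)
    (hab : b * a = a ^ 3 * b) (hG : Subgroup.closure {a, b} = ⊤) : IsPGroup 2 G := by
  intro g
  refine ⟨3, ?_⟩
  obtain ⟨i, rfl | rfl⟩ := exists_normal_form_of_semidihedral ha hb hab (hG ▸ Subgroup.mem_top g)
  · rw [← pow_mul, mul_comm, pow_mul, show 2 ^ 3 = 8 from rfl, ha, one_pow]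
  · rw [show 2 ^ 3 = 2 * 4 from rfl, pow_mul, sq_of_semidihedral hb hab, ← pow_mul,
      show 4 * i * 4 = 8 * (2 * i) by ring, pow_mul, ha, one_pow]

/-- The lifts of `sr 1` and `sr 3` are the `aⁱb` with `i` odd, whose square is `a⁴ⁱ = a⁴`. -/
theorem sq_ne_one_of_semidihedral (ha : a ^ 8 = 1) (ha4 : a ^ 4 ≠ 1) (hb : b ^ 2 = 1)
    (hab : b * a = a ^ 3 * b) (hG : Subgroup.closure {a, b} = ⊤) {f : G →* DihedralGroup 4}
    (hfa : f a = .r 1) (hfb : f b = .sr 0) (g : G) (hg : f g = .sr 1 ∨ f g = .sr 3) :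
    g ^ 2 ≠ 1 := by
  intro h
  obtain ⟨i, rfl | rfl⟩ := exists_normal_form_of_semidihedral ha hb hab (hG ▸ Subgroup.mem_top g)
  · rw [map_pow, hfa, DihedralGroup.r_pow] at hg
    simp at hg
  · rw [map_mul, map_pow, hfa, hfb, DihedralGroup.r_pow, DihedralGroup.r_mul_sr, one_mul] at hg
    rw [sq_of_semidihedral hb hab] at h
    rcases Nat.even_or_odd' i with ⟨l, rfl | rfl⟩
    · push_cast at hg
      generalize (l : ZMod 4) = z at hg
      revert z
      decide
    · rw [show 4 * (2 * l + 1) = 8 * l + 4 by ring, pow_add, pow_mul, ha, one_pow, one_mul] at h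
      exact ha4 h

end SemidihedralRelations

namespace SemidihedralGroup16

/-- The generator `a` of order `8`. -/
def genA : SemidihedralGroup16 := PresentedGroup.of 0

/-- The generator `b` of order `2`. -/
def genB : SemidihedralGroup16 := PresentedGroup.of 1

theorem genA_pow : genA ^ 8 = 1 := by
  have : PresentedGroup.mk _ (FreeGroup.of 0 ^ 8) = (1 : SemidihedralGroup16) :=
    PresentedGroup.one_of_mem (by simp)
  exact this

theorem genB_sq : genB ^ 2 = 1 := by
  have : PresentedGroup.mk _ (FreeGroup.of 1 ^ 2) = (1 : SemidihedralGroup16) :=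
    PresentedGroup.one_of_mem (by simp)
  exact this

theorem genB_mul_genA : genB * genA = genA ^ 3 * genB := by
  have : PresentedGroup.mk _ ((FreeGroup.of 1 * FreeGroup.of 0) *
      (FreeGroup.of 0 ^ 3 * FreeGroup.of 1)⁻¹) = (1 : SemidihedralGroup16) :=
    PresentedGroup.one_of_mem (by simp)
  exact mul_inv_eq_one.1 this

theorem closure_eq_top : Subgroup.closure {genA, genB} = ⊤ := by
  rw [← PresentedGroup.closure_range_of]
  congr 1
  ext x
  constructor
  · rintro (rfl | rfl)
    exacts [⟨0, rfl⟩, ⟨1, rfl⟩]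
  · rintro ⟨k, rfl⟩
    fin_cases k
    exacts [.inl rfl, .inr rfl]

/-- The epimorphism onto `D₈`. -/
def toDihedral : SemidihedralGroup16 →* DihedralGroup 4 :=
  PresentedGroup.toGroup (f := ![.r 1, .sr 0]) (by
    rintro x (rfl | rfl | rfl) <;> simp <;> decide)

theorem toDihedral_genA : toDihedral genA = .r 1 := PresentedGroup.toGroup.of _

theorem toDihedral_genB : toDihedral genB = .sr 0 := PresentedGroup.toGroup.of _

/-- The permutation representation on `ZMod 8` in which `a` acts by `x ↦ x + 1` and `b` by
`x ↦ 3 * x`. -/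
def toPerm : SemidihedralGroup16 →* Equiv.Perm (ZMod 8) :=
  PresentedGroup.toGroup
    (f := ![Equiv.addLeft 1, ⟨fun x => 3 * x, fun x => 3 * x, by decide, by decide⟩]) (by
    rintro x (rfl | rfl | rfl) <;>
      simp only [map_mul, map_inv, map_pow, FreeGroup.lift_apply_of] <;> decide)

/-- Relations alone do not exclude a collapse; in the permutation representation `a⁴` is the
nontrivial translation by 4. -/
theorem genA_pow_four_ne_one : genA ^ 4 ≠ 1 := by
  intro h
  have h2 := congrArg toPerm h
  rw [map_pow, map_one, show toPerm genA = Equiv.addLeft 1 from PresentedGroup.toGroup.of _] at h2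
  revert h2
  decide

end SemidihedralGroup16

open SemidihedralGroup16 in
theorem satisfiesLiftCondition_semidihedralGroup16 :
    SatisfiesLiftCondition SemidihedralGroup16 := by
  exact ⟨finite_of_semidihedral genA_pow genB_sq genB_mul_genA closure_eq_top,
    isPGroup_of_semidihedral genA_pow genB_sq genB_mul_genA closure_eq_top, toDihedral,
    surjective_of_mem_range ⟨_, toDihedral_genA⟩ ⟨_, toDihedral_genB⟩,
    atLeastTwoWithoutInvolutiveLift_of_reflections <|
      sq_ne_one_of_semidihedral genA_pow genA_pow_four_ne_one genB_sq genB_mul_genA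
        closure_eq_top toDihedral_genA toDihedral_genB⟩

end GroupRingUnits

theorem mainTheorem3 :
    (∀ (G : Type*) [Group G] [Finite G], IsPGroup 2 G →
      ∀ f : G →* DihedralGroup 4, Function.Surjective f →
        GroupRingUnits.AtLeastTwoWithoutInvolutiveLift f →
        ¬ (GroupRingUnits.bassBicyclicSubgroup G).FiniteIndex) ∧
    (GroupRingUnits.SatisfiesLiftCondition (QuaternionGroup 4) ∧
      ¬ (GroupRingUnits.bassBicyclicSubgroup (QuaternionGroup 4)).FiniteIndex) ∧
    (GroupRingUnits.SatisfiesLiftCondition GroupRingUnits.SemidihedralGroup16 ∧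
      ¬ (GroupRingUnits.bassBicyclicSubgroup GroupRingUnits.SemidihedralGroup16).FiniteIndex) ∧
    (GroupRingUnits.SatisfiesLiftCondition GroupRingUnits.C4SemidirectC4 ∧
      ¬ (GroupRingUnits.bassBicyclicSubgroup GroupRingUnits.C4SemidirectC4).FiniteIndex) ∧
    (GroupRingUnits.SatisfiesLiftCondition GroupRingUnits.C2C4SemidirectC2 ∧
      ¬ (GroupRingUnits.bassBicyclicSubgroup GroupRingUnits.C2C4SemidirectC2).FiniteIndex) := by
  have hQ := GroupRingUnits.satisfiesLiftCondition_quaternionGroup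
  have hS := GroupRingUnits.satisfiesLiftCondition_semidihedralGroup16
  have hC := GroupRingUnits.satisfiesLiftCondition_c4SemidirectC4
  have hD := GroupRingUnits.satisfiesLiftCondition_c2C4SemidirectC2
  exact ⟨fun _ _ _ hG f => GroupRingUnits.not_finiteIndex_of_lift_condition hG f,
    ⟨hQ, hQ.not_finiteIndex⟩, ⟨hS, hS.not_finiteIndex⟩, ⟨hC, hC.not_finiteIndex⟩,
    ⟨hD, hD.not_finiteIndex⟩⟩
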